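/- For a positive integer $r$, an $r$-graph is a pair $(V,c)$ with $V$ a finite set and $c:\binom V2\to\{1,\dots,r\}$. A digraph is a pair $(V,F)$ with $V$ a finite set and $F\subseteq\{(v,w)\in V\times V: v\ne w\}$; an ordered pair $(v,w)$ of distinct vertices of a digraph has exactly one of four colors, according to which of $(v,w)$, $(w,v)$ belong to $F$ (neither, both, only $(v,w)$, only $(w,v)$). For disjoint non-empty $X,Y\subseteq V$ and a color $\rho$, let $d_\rho(X,Y)=e_\rho(X,Y)/(|X||Y|)$, where $e_\rho(X,Y)$ is the number of pairs $(x,y)\in X\times Y$ of color $\rho$. For $\gamma>0$, the pair $(X,Y)$ is $\gamma$-regular if $|d_\rho(X',Y')-d_\rho(X,Y)|\le\gamma$ for every color $\rho$ and all $X'\subseteq X$, $Y'\subseteq Y$ with $|X'|\ge\gamma|X|$ and $|Y'|\ge\gamma|Y|$. An equipartition of $V$ is a partition of $V$ into non-empty parts whose sizes differ pairwise by at most $1$. **Statement.** Let $r$ be a positive integer, let $m$ be an integer and let $\mathcal E:\{0,1,2,\dots\}\to(0,1)$ be a function. There is a number $S$, depending only on $r$, $m$ and $\mathcal E$, such that for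 every $r$-graph and every digraph on a set $V$ of $n\ge S$ vertices there are $k$ and $\ell$ with $k\ge m$ and $k\ell\le S$, an equipartition $\mathcal A=\{V_i:1\le i\le k\}$ of $V$ into $k$ parts, and an equipartition $\mathcal B=\{V_{i,j}:1\le i\le k,\ 1\le j\le\ell\}$ of $V$ into $k\ell$ parts with $V_i=\bigcup_{j=1}^{\ell}V_{i,j}$ for every $i$ (so $\mathcal B$ refines $\mathcal A$), satisfying: 1. For all $1\le i<i'\le k$ but at most $\mathcal E(0)\binom k2$ of these pairs, $(V_i,V_{i'})$ is $\mathcal E(0)$-regular. 2. For every $1\le i<i'\le k$, for all $(j,j')\in\{1,\dots,\ell\}^2$ but at most $\mathcal E(k)\ell^2$ of them, $(V_{i,j},V_{i',j'})$ is $\mathcal E(k)$-regular. 3. For all $1\le i<i'\le k$ but at most $\mathcal E(0)\binom k2$ of these pairs, the following holds: for all $(j,j')\in\{1,\dots,\ell\}^2$ but at most $\mathcal E(0)\ell^2$ of them, $|d_\rho(V_i,V_{i'})-d_\rho(V_{i,j},V_{i',j'})|<\mathcal E(0)$ for every color $\rho$. -/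

import Mathlib

namespace ColoredRegularity

/-- The four colors of an ordered pair of distinct vertices of a digraph. -/
inductive ArcColor : Type
  | nonArc
  | bothArcs
  | backward
  | forward

/-- `arcHasColor G ρ v w`: the ordered pair `(v, w)` has color `ρ` in the digraph `G`. -/
def arcHasColor {V : Type*} (G : Digraph V) : ArcColor → V → V → Prop
  | .nonArc, v, w => ¬ G.Adj v w ∧ ¬ G.Adj w v
  | .bothArcs, v, w => G.Adj v w ∧ G.Adj w v
  | .backward, v, w => ¬ G.Adj v w ∧ G.Adj w v
  | .forward, v, w => G.Adj v w ∧ ¬ G.Adj w v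

/-- `edgeHasColor c ρ v w`: the vertices `v`, `w` are distinct and the edge `vw` of the complete
graph has color `ρ` in the `r`-graph `(V, c)`. -/
def edgeHasColor {V : Type*} {r : ℕ} (c : SimpleGraph.TopEdgeLabeling V (Fin r)) (ρ : Fin r)
    (v w : V) : Prop :=
  ∃ h : v ≠ w, c.get v w ((SimpleGraph.top_adj v w).2 h) = ρ

open Classical in
/-- The density `d_ρ(X, Y) = e_ρ(X, Y) / (|X| |Y|)`, where `col ρ v w` says that the pair `(v, w)`
has color `ρ`. -/
noncomputable def colorDensity {V K : Type*} (col : K → V → V → Prop) (ρ : K)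
    (X Y : Finset V) : ℝ :=
  (Rel.edgeDensity (col ρ) X Y : ℝ)

/-- The pair `(X, Y)` is `γ`-regular, simultaneously for all colors. -/
def IsRegularPair {V K : Type*} (col : K → V → V → Prop) (γ : ℝ) (X Y : Finset V) : Prop :=
  ∀ X' ⊆ X, ∀ Y' ⊆ Y, γ * (X.card : ℝ) ≤ (X'.card : ℝ) → γ * (Y.card : ℝ) ≤ (Y'.card : ℝ) →
    ∀ ρ : K, |colorDensity col ρ X' Y' - colorDensity col ρ X Y| ≤ γ

/-- The family `P` is an equipartition of `V`: its members are non-empty, pairwise disjoint, cover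
`V`, and their sizes differ by at most one. -/
structure IsEquipartition {V ι : Type*} (P : ι → Finset V) : Prop where
  nonempty : ∀ i, (P i).Nonempty
  disjoint : ∀ i i', i ≠ i' → Disjoint (P i) (P i')
  cover : ∀ v, ∃ i, v ∈ P i
  card_le : ∀ i i', (P i).card ≤ (P i').card + 1

open Classical in
/-- `A = {V_i}` is an equipartition of `V` into `k` parts and `B = {V_{i,j}}` is an equipartition
of `V` into `k * l` parts that refines `A`, with the regularity and density properties
prescribed by `E`. -/
structure IsRegularRefinement {V K : Type*} (col : K → V → V → Prop) (E : ℕ → ℝ) {k l : ℕ}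
    (A : Fin k → Finset V) (B : Fin k → Fin l → Finset V) : Prop where
  equipartition : IsEquipartition A
  equipartition_refinement : IsEquipartition (fun p : Fin k × Fin l => B p.1 p.2)
  refines : ∀ i v, v ∈ A i ↔ ∃ j, v ∈ B i j
  regular : ((Finset.univ.filter fun p : Fin k × Fin k =>
      p.1 < p.2 ∧ ¬ IsRegularPair col (E 0) (A p.1) (A p.2)).card : ℝ) ≤
    E 0 * (k.choose 2 : ℝ)
  regular_refinement : ∀ i i' : Fin k, i < i' →
    ((Finset.univ.filter fun q : Fin l × Fin l =>
      ¬ IsRegularPair col (E k) (B i q.1) (B i' q.2)).card : ℝ) ≤ E k * (l : ℝ) ^ 2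
  density_close : ((Finset.univ.filter fun p : Fin k × Fin k =>
      p.1 < p.2 ∧ ¬ (((Finset.univ.filter fun q : Fin l × Fin l =>
        ¬ ∀ ρ : K, |colorDensity col ρ (A p.1) (A p.2) -
          colorDensity col ρ (B p.1 q.1) (B p.2 q.2)| < E 0).card : ℝ) ≤
        E 0 * (l : ℝ) ^ 2)).card : ℝ) ≤
    E 0 * (k.choose 2 : ℝ)

end ColoredRegularity

/-! A partition of V is encoded by a labeling `f`. Its `energy` adds up, over the colors, the
squared L² norm of the conditional expectation on V × V of the color indicator given the pair of
labels. By Pythagoras, a refinement raises the energy by exactly the squared L² distance between the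
two step functions. Since the energy is at most |K||V|², increments of a fixed proportion of |V|²
can occur only boundedly often. This is used twice.

Inner iteration: if more than an ε-fraction of the pairs of classes is irregular, cutting along
witnesses gains ε⁵|V|²/4 (`Equitable.exists_energy_increment`), and an equitable labeling into
boundedly many classes keeps at least half of the gain (`Equitable.exists_refinement_energy`). Hence
every equipartition has an ε-regular equitable refinement of bounded size
(`exists_regular_refinement`).

Outer iteration: a coarse partition into k classes is refined with a regularity parameter depending
on k. If the energy rises by at most E(0)⁴|V|²/16, a Chebyshev argument shows that most densities
hardly change, and the two partitions are as required (`isRegularRefinement_of_energy`). Otherwise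
the refinement becomes the new coarse partition.

All this works for any finite family of binary relations, so graphs and digraphs are treated alike.
-/

namespace ColoredRegularity
open Finset

/-! ### Conditional expectation with respect to a labeling -/

section FiberMean

variable {Ω κ κ' : Type*} [Fintype Ω]

open Classical in
/-- The class of the labeling `F` with label `i`. -/
noncomputable def fiber (F : Ω → κ) (i : κ) : Finset Ω := univ.filter fun ω => F ω = i

@[simp]
theorem mem_fiber {F : Ω → κ} {i : κ} {ω : Ω} : ω ∈ fiber F i ↔ F ω = i := by
  simp [fiber]

/-- The conditional expectation of `u` with respect to the labeling `F`, for the counting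
measure. -/
noncomputable def fiberMean (F : Ω → κ) (u : Ω → ℝ) (ω : Ω) : ℝ :=
  (∑ ω' ∈ fiber F (F ω), u ω') / (fiber F (F ω)).card

theorem fiberMean_eq_of_label_eq {F : Ω → κ} {u : Ω → ℝ} {ω ω' : Ω} (h : F ω = F ω') :
    fiberMean F u ω = fiberMean F u ω' := by
  simp only [fiberMean, h]

theorem fiberMean_nonneg {F : Ω → κ} {u : Ω → ℝ} (hu : ∀ ω, 0 ≤ u ω) (ω : Ω) :
    0 ≤ fiberMean F u ω :=
  div_nonneg (sum_nonneg fun _ _ => hu _) (Nat.cast_nonneg _)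

theorem fiberMean_le_one {F : Ω → κ} {u : Ω → ℝ} (hu : ∀ ω, u ω ≤ 1) (ω : Ω) :
    fiberMean F u ω ≤ 1 := by
  refine div_le_one_of_le₀ ?_ (Nat.cast_nonneg _)
  calc ∑ ω' ∈ fiber F (F ω), u ω' ≤ ∑ _ω' ∈ fiber F (F ω), (1 : ℝ) := sum_le_sum fun _ _ => hu _
    _ = _ := by simp

/-- Conditional expectation is the orthogonal projection onto the functions constant on the classes,
of which `φ` is one. -/
theorem sum_fiberMean_mul (F : Ω → κ) (u φ : Ω → ℝ)
    (hφ : ∀ ω ω', F ω = F ω' → φ ω = φ ω') :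
    ∑ ω, fiberMean F u ω * φ ω = ∑ ω, u ω * φ ω := by
  have h₁ : ∀ ω, fiberMean F u ω * φ ω =
      ∑ ω' ∈ fiber F (F ω), u ω' * φ ω / (fiber F (F ω)).card := fun ω => by
    rw [fiberMean, div_mul_eq_mul_div, sum_mul, sum_div]
  simp only [h₁]
  rw [sum_comm' (t' := univ) (s' := fun ω' => fiber F (F ω')) (by simp [eq_comm])]
  refine sum_congr rfl fun ω' _ => ?_
  have h₂ : ∀ ω ∈ fiber F (F ω'), u ω' * φ ω / ((fiber F (F ω)).card : ℝ) =
      u ω' * φ ω' / ((fiber F (F ω')).card : ℝ) := fun ω hω => by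
    rw [mem_fiber.1 hω, hφ ω ω' (mem_fiber.1 hω)]
  rw [sum_congr rfl h₂, sum_const, nsmul_eq_mul]
  have : ((fiber F (F ω')).card : ℝ) ≠ 0 := by
    exact_mod_cast (card_pos.2 ⟨ω', by simp⟩).ne'
  field_simp

/-- Pythagoras: as `G` refines `F`, both means have the same inner product with the `F`-mean. -/
theorem sum_sq_fiberMean_sub (F : Ω → κ) (G : Ω → κ') (u : Ω → ℝ)
    (h : ∀ ω ω', G ω = G ω' → F ω = F ω') :
    ∑ ω, (fiberMean G u ω - fiberMean F u ω) ^ 2 =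
      ∑ ω, fiberMean G u ω ^ 2 - ∑ ω, fiberMean F u ω ^ 2 := by
  have h₁ : ∑ ω, fiberMean G u ω * fiberMean F u ω = ∑ ω, fiberMean F u ω * fiberMean F u ω := by
    rw [sum_fiberMean_mul G u _ fun ω ω' hω => fiberMean_eq_of_label_eq (h ω ω' hω),
      sum_fiberMean_mul F u _ fun ω ω' hω => fiberMean_eq_of_label_eq hω]
  calc ∑ ω, (fiberMean G u ω - fiberMean F u ω) ^ 2
      = ∑ ω, fiberMean G u ω ^ 2 - 2 * ∑ ω, fiberMean G u ω * fiberMean F u ω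
        + ∑ ω, fiberMean F u ω * fiberMean F u ω := by
        rw [mul_sum, ← sum_sub_distrib, ← sum_add_distrib]
        exact sum_congr rfl fun ω _ => by ring
    _ = _ := by
        rw [h₁]
        simp only [← sq]
        ring

end FiberMean

/-! ### Energy of a labeling -/

section Energy

variable {V K ι κ : Type*}

open Classical in
/-- The indicator function of the pairs of color `ρ`. -/
noncomputable def colorIndicator (col : K → V → V → Prop) (ρ : K) (ω : V × V) : ℝ :=
  if col ρ ω.1 ω.2 then 1 else 0

theorem colorIndicator_nonneg (col : K → V → V → Prop) (ρ : K) (ω : V × V) :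
    0 ≤ colorIndicator col ρ ω := by
  unfold colorIndicator; split_ifs <;> norm_num

theorem colorIndicator_le_one (col : K → V → V → Prop) (ρ : K) (ω : V × V) :
    colorIndicator col ρ ω ≤ 1 := by
  unfold colorIndicator; split_ifs <;> norm_num

theorem colorDensity_eq (col : K → V → V → Prop) (ρ : K) (X Y : Finset V) :
    colorDensity col ρ X Y =
      (∑ ω ∈ X ×ˢ Y, colorIndicator col ρ ω) / ((X.card : ℝ) * Y.card) := by
  classical
  simp only [colorDensity, Rel.edgeDensity, Rel.interedges, colorIndicator, sum_boole]
  push_cast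
  congr!

variable [Fintype V]

theorem fiber_prodMap (f : V → ι) (i i' : ι) :
    fiber (Prod.map f f) (i, i') = fiber f i ×ˢ fiber f i' := by
  ext ⟨x, y⟩
  simp

theorem fiberMean_prodMap (col : K → V → V → Prop) (ρ : K) (f : V → ι) (ω : V × V) :
    fiberMean (Prod.map f f) (colorIndicator col ρ) ω =
      colorDensity col ρ (fiber f (f ω.1)) (fiber f (f ω.2)) := by
  rw [fiberMean, colorDensity_eq, Prod.map_apply', fiber_prodMap, card_product, Nat.cast_mul]

/-- The sum over all colors of the squared `L²` norm of the step function given by the densities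
between the classes of `f`. -/
noncomputable def energy [Fintype K] (col : K → V → V → Prop) (f : V → ι) : ℝ :=
  ∑ ρ, ∑ ω, fiberMean (Prod.map f f) (colorIndicator col ρ) ω ^ 2

variable [Fintype K]

theorem energy_nonneg (col : K → V → V → Prop) (f : V → ι) : 0 ≤ energy col f :=
  sum_nonneg fun _ _ => sum_nonneg fun _ _ => sq_nonneg _

theorem energy_le (col : K → V → V → Prop) (f : V → ι) :
    energy col f ≤ Fintype.card K * (Fintype.card V : ℝ) ^ 2 := by
  calc energy col f ≤ ∑ _ρ : K, ∑ _ω : V × V, (1 : ℝ) :=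
        sum_le_sum fun ρ _ => sum_le_sum fun ω _ => pow_le_one₀
          (fiberMean_nonneg (colorIndicator_nonneg col ρ) ω)
          (fiberMean_le_one (colorIndicator_le_one col ρ) ω)
    _ = _ := by simp [Fintype.card_prod, sq]

theorem energy_sub_energy (col : K → V → V → Prop) (f : V → ι) (g : V → κ)
    (h : ∀ x y, g x = g y → f x = f y) :
    energy col g - energy col f =
      ∑ ω : V × V, ∑ ρ, (fiberMean (Prod.map g g) (colorIndicator col ρ) ω -
        fiberMean (Prod.map f f) (colorIndicator col ρ) ω) ^ 2 := by
  rw [sum_comm, energy, energy, ← sum_sub_distrib]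
  refine sum_congr rfl fun ρ _ => (sum_sq_fiberMean_sub _ _ _ ?_).symm
  rintro ⟨x, y⟩ ⟨x', y'⟩ hω
  simp only [Prod.map_apply, Prod.mk.injEq] at hω ⊢
  exact ⟨h _ _ hω.1, h _ _ hω.2⟩

theorem energy_mono (col : K → V → V → Prop) (f : V → ι) (g : V → κ)
    (h : ∀ x y, g x = g y → f x = f y) : energy col f ≤ energy col g := by
  have : 0 ≤ energy col g - energy col f := by
    rw [energy_sub_energy col f g h]
    exact sum_nonneg fun _ _ => sum_nonneg fun _ _ => sq_nonneg _
  linarith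

theorem energy_congr_equiv (col : K → V → V → Prop) (f : V → ι) (e : ι ≃ κ) :
    energy col (e ∘ f) = energy col f :=
  le_antisymm (energy_mono _ _ _ fun x y h => by simp [h])
    (energy_mono _ _ _ fun x y h => by simpa using h)

/-- Splitting the classes of `g` along `C` raises the energy by at most the measure of the pairs
that meet a class of `g` on which `C` is not constant. -/
theorem energy_le_add_of_bad (col : K → V → V → Prop) (g : V → ι) (C : V → κ) (Z : Finset V)
    (hZ : ∀ x y, g x = g y → C x ≠ C y → x ∈ Z) :
    energy col C ≤ energy col g +
      2 * Fintype.card K * Z.card * Fintype.card V := by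
  classical
  -- Neither of `g` and `C` need refine the other, so they are compared through their common
  -- refinement, whose step function agrees with that of `g` on pairs avoiding `Z`.
  set D : V → ι × κ := fun x => (g x, C x) with hD
  have h₁ : energy col C ≤ energy col D :=
    energy_mono _ _ _ fun x y h => by
      simp only [hD, Prod.mk.injEq] at h
      exact h.2
  have hfib : ∀ x ∉ Z, fiber D (D x) = fiber g (g x) := fun x hx => by
    ext y
    simp only [hD, mem_fiber, Prod.mk.injEq, and_iff_left_iff_imp]
    intro hxy
    by_contra hne
    exact hx (hZ x y hxy.symm (Ne.symm hne))
  have h₂ : ∀ ρ (ω : V × V), fiberMean (Prod.map D D) (colorIndicator col ρ) ω ^ 2 ≤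
      fiberMean (Prod.map g g) (colorIndicator col ρ) ω ^ 2 +
        ((if ω ∈ Z ×ˢ univ then 1 else 0) + (if ω ∈ univ ×ˢ Z then 1 else 0)) := by
    intro ρ ω
    have hle : fiberMean (Prod.map D D) (colorIndicator col ρ) ω ^ 2 ≤ 1 := pow_le_one₀
          (fiberMean_nonneg (colorIndicator_nonneg col ρ) ω)
          (fiberMean_le_one (colorIndicator_le_one col ρ) ω)
    have hsq := sq_nonneg (fiberMean (Prod.map g g) (colorIndicator col ρ) ω)
    by_cases hx : ω.1 ∈ Z
    · have : (0 : ℝ) ≤ if ω ∈ univ ×ˢ Z then 1 else 0 := by split_ifs <;> norm_num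
      rw [if_pos (by simp [hx])]
      linarith
    by_cases hy : ω.2 ∈ Z
    · have : (0 : ℝ) ≤ if ω ∈ Z ×ˢ univ then 1 else 0 := by split_ifs <;> norm_num
      rw [if_pos (show ω ∈ univ ×ˢ Z by simp [hy])]
      linarith
    · rw [if_neg (by simp [hx]), if_neg (by simp [hy]), fiberMean_prodMap, fiberMean_prodMap,
        hfib _ hx, hfib _ hy]
      simp
  have h₃ : energy col D ≤ energy col g + ∑ _ρ : K, ∑ ω : V × V,
      (((if ω ∈ Z ×ˢ univ then 1 else 0) + (if ω ∈ univ ×ˢ Z then 1 else 0)) : ℝ) := by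
    rw [energy, energy, ← sum_add_distrib]
    refine sum_le_sum fun ρ _ => ?_
    rw [← sum_add_distrib]
    exact sum_le_sum fun ω _ => h₂ ρ ω
  refine (h₁.trans h₃).trans (le_of_eq ?_)
  rw [sum_const, sum_add_distrib, sum_boole, sum_boole, filter_mem_eq_inter, filter_mem_eq_inter]
  simp only [univ_inter, card_product, card_univ, nsmul_eq_mul]
  push_cast
  ring

end Energy

/-! ### Energy increment from irregular pairs -/

section Increment

variable {V K ι : Type*}

theorem IsRegularPair.mono {col : K → V → V → Prop} {γ γ' : ℝ} {X Y : Finset V} (h : γ ≤ γ')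
    (hγ : IsRegularPair col γ X Y) : IsRegularPair col γ' X Y :=
  fun X' hX Y' hY hX' hY' ρ =>
    (hγ X' hX Y' hY ((mul_le_mul_of_nonneg_right h (Nat.cast_nonneg _)).trans hX')
      ((mul_le_mul_of_nonneg_right h (Nat.cast_nonneg _)).trans hY') ρ).trans h

variable [Fintype V]

open Classical in
/-- The pairs of labels whose classes do not form a `γ`-regular pair. -/
noncomputable def irregularPairs [Fintype ι] (col : K → V → V → Prop) (γ : ℝ) (f : V → ι) :
    Finset (ι × ι) :=
  univ.filter fun p => ¬ IsRegularPair col γ (fiber f p.1) (fiber f p.2)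

@[simp]
theorem mem_irregularPairs [Fintype ι] {col : K → V → V → Prop} {γ : ℝ} {f : V → ι}
    {p : ι × ι} :
    p ∈ irregularPairs col γ f ↔ ¬ IsRegularPair col γ (fiber f p.1) (fiber f p.2) := by
  simp [irregularPairs]

theorem irregularPairs_anti [Fintype ι] {col : K → V → V → Prop} {γ γ' : ℝ} (h : γ ≤ γ')
    (f : V → ι) : irregularPairs col γ' f ⊆ irregularPairs col γ f := by
  intro p
  simp only [mem_irregularPairs]
  exact mt (IsRegularPair.mono h)

/-- Cauchy–Schwarz on X × Y. Since X and Y are unions of classes of `C`, the `C`-mean averages there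
to the density of (X, Y), while the `f`-mean is constant. -/
theorem mul_sq_le_sum_fiberMean_sub {κ : Type*} (col : K → V → V → Prop) (ρ : K) {f : V → ι}
    {C : V → κ} {i i' : ι} {X Y : Finset V} (hX : X ⊆ fiber f i) (hY : Y ⊆ fiber f i')
    (hCX : ∀ x y, C x = C y → (x ∈ X ↔ y ∈ X)) (hCY : ∀ x y, C x = C y → (x ∈ Y ↔ y ∈ Y)) :
    (X.card : ℝ) * Y.card *
        (colorDensity col ρ X Y - colorDensity col ρ (fiber f i) (fiber f i')) ^ 2 ≤
      ∑ ω ∈ X ×ˢ Y, (fiberMean (Prod.map C C) (colorIndicator col ρ) ω -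
        fiberMean (Prod.map f f) (colorIndicator col ρ) ω) ^ 2 := by
  classical
  rcases X.eq_empty_or_nonempty with rfl | hXne
  · simp
  rcases Y.eq_empty_or_nonempty with rfl | hYne
  · simp
  have hX0 : (0 : ℝ) < X.card := by exact_mod_cast hXne.card_pos
  have hY0 : (0 : ℝ) < Y.card := by exact_mod_cast hYne.card_pos
  have h₁ : ∑ ω ∈ X ×ˢ Y, fiberMean (Prod.map C C) (colorIndicator col ρ) ω =
      X.card * Y.card * colorDensity col ρ X Y := by
    have := sum_fiberMean_mul (Prod.map C C) (colorIndicator col ρ)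
      (fun ω => if ω ∈ X ×ˢ Y then 1 else 0) (by
        rintro ⟨x, y⟩ ⟨x', y'⟩ h
        simp only [Prod.map_apply, Prod.mk.injEq] at h
        simp only [mem_product, hCX x x' h.1, hCY y y' h.2])
    simp only [mul_ite, mul_one, mul_zero, sum_ite_mem, univ_inter] at this
    rw [this, colorDensity_eq]
    field_simp
  have h₂ : ∑ ω ∈ X ×ˢ Y, fiberMean (Prod.map f f) (colorIndicator col ρ) ω =
      X.card * Y.card * colorDensity col ρ (fiber f i) (fiber f i') := by
    rw [sum_congr rfl fun ω hω => ?_, sum_const, card_product, nsmul_eq_mul, Nat.cast_mul]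
    rw [fiberMean_prodMap, mem_fiber.1 (hX (mem_product.1 hω).1),
      mem_fiber.1 (hY (mem_product.1 hω).2)]
  have h₃ := sq_sum_le_card_mul_sum_sq (s := X ×ˢ Y)
    (f := fun ω => fiberMean (Prod.map C C) (colorIndicator col ρ) ω -
        fiberMean (Prod.map f f) (colorIndicator col ρ) ω)
  rw [sum_sub_distrib, h₁, h₂, card_product, ← mul_sub, mul_pow, Nat.cast_mul] at h₃
  have h₄ : (0 : ℝ) < X.card * Y.card := mul_pos hX0 hY0
  refine le_of_mul_le_mul_left ?_ h₄
  calc _ = ((X.card : ℝ) * Y.card) ^ 2 *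
        (colorDensity col ρ X Y - colorDensity col ρ (fiber f i) (fiber f i')) ^ 2 := by ring
    _ ≤ _ := h₃

/-- All classes are cut simultaneously along one witness (X, Y) for each irregular pair. In ε⁴, two
factors come from the sizes of X and Y, and two from the squared density deviation. -/
theorem exists_energy_increment [Fintype K] [Fintype ι] (col : K → V → V → Prop) (f : V → ι)
    {ε : ℝ} (hε : 0 < ε) :
    ∃ C : V → ι × (ι × ι → Bool × Bool),
      energy col f + ε ^ 4 * ∑ p ∈ irregularPairs col ε f,
        ((fiber f p.1).card : ℝ) * (fiber f p.2).card ≤ energy col C := by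
  classical
  have hw : ∀ p : ι × ι, ∃ (X Y : Finset V), p ∈ irregularPairs col ε f →
      X ⊆ fiber f p.1 ∧ Y ⊆ fiber f p.2 ∧ ε * ((fiber f p.1).card : ℝ) ≤ X.card ∧
      ε * ((fiber f p.2).card : ℝ) ≤ Y.card ∧ ∃ ρ,
        ε < |colorDensity col ρ X Y - colorDensity col ρ (fiber f p.1) (fiber f p.2)| := by
    intro p
    by_cases hp : p ∈ irregularPairs col ε f
    · have := mem_irregularPairs.1 hp
      simp only [IsRegularPair] at this
      push Not at this
      obtain ⟨X, hX, Y, hY, h₁, h₂, ρ, h₃⟩ := this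
      exact ⟨X, Y, fun _ => ⟨hX, hY, h₁, h₂, ρ, h₃⟩⟩
    · exact ⟨∅, ∅, fun h => absurd h hp⟩
  choose X Y hXY using hw
  refine ⟨fun x => (f x, fun p => (decide (x ∈ X p), decide (x ∈ Y p))), ?_⟩
  set C : V → ι × (ι × ι → Bool × Bool) :=
    fun x => (f x, fun p => (decide (x ∈ X p), decide (x ∈ Y p))) with hC
  have hCX : ∀ p x y, C x = C y → (x ∈ X p ↔ y ∈ X p) := fun p x y h => by
    have := congrArg (fun c => (c.2 p).1) h
    simpa [hC] using this
  have hCY : ∀ p x y, C x = C y → (x ∈ Y p ↔ y ∈ Y p) := fun p x y h => by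
    have := congrArg (fun c => (c.2 p).2) h
    simpa [hC] using this
  have h₀ := energy_sub_energy col f C fun x y h => congrArg Prod.fst h
  set Φ : V × V → ℝ := fun ω => ∑ ρ, (fiberMean (Prod.map C C) (colorIndicator col ρ) ω -
        fiberMean (Prod.map f f) (colorIndicator col ρ) ω) ^ 2 with hΦ
  have hΦ0 : ∀ ω, 0 ≤ Φ ω := fun ω => sum_nonneg fun _ _ => sq_nonneg _
  have h₁ : ∑ p : ι × ι, ∑ ω ∈ fiber f p.1 ×ˢ fiber f p.2, Φ ω = ∑ ω, Φ ω := by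
    rw [← sum_fiberwise univ (Prod.map f f) Φ]
    refine sum_congr rfl fun p _ => sum_congr ?_ fun _ _ => rfl
    ext ω
    simp [Prod.ext_iff]
  have h₂ : ∀ p ∈ irregularPairs col ε f,
      ε ^ 4 * (((fiber f p.1).card : ℝ) * (fiber f p.2).card) ≤
        ∑ ω ∈ fiber f p.1 ×ˢ fiber f p.2, Φ ω := by
    intro p hp
    obtain ⟨hX, hY, h₁, h₂, ρ, h₃⟩ := hXY p hp
    have h₄ : ε ^ 2 ≤
        (colorDensity col ρ (X p) (Y p) - colorDensity col ρ (fiber f p.1) (fiber f p.2)) ^ 2 := by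
      rw [← sq_abs (_ - _)]
      exact pow_le_pow_left₀ hε.le h₃.le 2
    calc ε ^ 4 * (((fiber f p.1).card : ℝ) * (fiber f p.2).card)
        = (ε * (fiber f p.1).card) * (ε * (fiber f p.2).card) * ε ^ 2 := by ring
      _ ≤ (X p).card * (Y p).card * (colorDensity col ρ (X p) (Y p) -
            colorDensity col ρ (fiber f p.1) (fiber f p.2)) ^ 2 := by gcongr
      _ ≤ _ := mul_sq_le_sum_fiberMean_sub col ρ hX hY (hCX p) (hCY p)
      _ ≤ ∑ ω ∈ X p ×ˢ Y p, Φ ω := sum_le_sum fun ω _ =>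
          single_le_sum (f := fun ρ => (fiberMean (Prod.map C C) (colorIndicator col ρ) ω -
            fiberMean (Prod.map f f) (colorIndicator col ρ) ω) ^ 2)
            (fun _ _ => sq_nonneg _) (mem_univ ρ)
      _ ≤ _ := sum_le_sum_of_subset_of_nonneg (product_subset_product hX hY)
          fun ω _ _ => hΦ0 ω
  have h₃ : ε ^ 4 * ∑ p ∈ irregularPairs col ε f,
      ((fiber f p.1).card : ℝ) * (fiber f p.2).card ≤ ∑ ω, Φ ω := by
    rw [mul_sum, ← h₁]
    exact (sum_le_sum h₂).trans (sum_le_sum_of_subset_of_nonneg (subset_univ _)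
      fun p _ _ => sum_nonneg fun ω _ => hΦ0 ω)
  linarith

end Increment

/-! ### Equitable labelings -/

section Equitable

variable {V ι κ : Type*}

open Classical in
/-- A finite set can be split into `l` parts of almost equal sizes such that few elements lie in
a part on which a given labeling `C` is not constant. -/
theorem exists_equitable_split [Fintype κ] (s : Finset V) (C : V → κ) {l : ℕ} (hl : 0 < l)
    (hs : l ≤ s.card) :
    ∃ h : V → Fin l,
      (∀ j, s.card / l ≤ (s.filter fun x => h x = j).card ∧
        (s.filter fun x => h x = j).card ≤ (s.card + l - 1) / l) ∧
      (s.filter fun x => ∃ y ∈ s, h y = h x ∧ C y ≠ C x).card ≤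
        Fintype.card κ * (s.card / l) := by
  set m := s.card / l with hm
  have hm0 : m ≠ 0 := (Nat.div_pos hs hl).ne'
  have hcard : (l - s.card % l) * m + s.card % l * (m + 1) = s.card := by
    rw [tsub_mul, mul_add, ← add_assoc,
      tsub_add_cancel_of_le (Nat.mul_le_mul_right _ (Nat.mod_lt _ hl).le), mul_one, add_comm,
      Nat.mod_add_div]
  set P : Finpartition s := Finpartition.ofSetSetoid (Setoid.ker C) s with hP
  set Q := P.equitabilise hcard with hQ
  have hQcard : Q.parts.card = l := by
    rw [hQ, P.card_parts_equitabilise hcard hm0, tsub_add_cancel_of_le (Nat.mod_lt _ hl).le]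
  have hPcard : P.parts.card ≤ Fintype.card κ := by
    have : P.parts ⊆ univ.image fun c : κ => s.filter fun x => C x = c := by
      intro t ht
      rw [hP, Finpartition.ofSetSetoid_parts, mem_image] at ht
      obtain ⟨a, ha, rfl⟩ := ht
      refine mem_image.2 ⟨C a, mem_univ _, filter_congr fun b _ => ?_⟩
      exact ⟨fun h => Eq.symm h, fun h => Eq.symm h⟩
    exact (card_le_card this).trans card_image_le
  let e : Q.parts ≃ Fin l := Q.parts.equivFinOfCardEq hQcard
  let h : V → Fin l := fun x => if hx : x ∈ s then e ⟨Q.part x, Q.part_mem.2 hx⟩ else ⟨0, hl⟩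
  have hh : ∀ x (hx : x ∈ s), h x = e ⟨Q.part x, Q.part_mem.2 hx⟩ := fun x hx => dif_pos hx
  have hfib : ∀ t : Q.parts, (s.filter fun x => h x = e t) = t := by
    intro t
    ext x
    simp only [mem_filter]
    constructor
    · rintro ⟨hx, hxt⟩
      rw [hh x hx, e.apply_eq_iff_eq] at hxt
      rw [← hxt]
      exact Q.mem_part_self.2 hx
    · intro hx
      have hxs : x ∈ s := Q.subset t.2 hx
      refine ⟨hxs, ?_⟩
      rw [hh x hxs, e.apply_eq_iff_eq]
      exact Subtype.ext (Q.part_eq_of_mem t.2 hx)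
  refine ⟨h, fun j => ?_, ?_⟩
  · obtain ⟨t, rfl⟩ := e.surjective j
    rw [hfib t]
    rcases Finpartition.card_eq_of_mem_parts_equitabilise t.2 with ht | ht
    · rw [ht]
      exact ⟨le_rfl, Nat.div_le_div_right (by omega)⟩
    · rw [ht]
      refine ⟨Nat.le_succ _, ?_⟩
      -- A part of size m + 1 occurs only if l does not divide |s|, and then m + 1 is the ceiling of
      -- |s| / l.
      have hb : 0 < s.card % l := by
        rw [← P.card_filter_equitabilise_big hcard, card_pos]
        exact ⟨t, mem_filter.2 ⟨t.2, ht⟩⟩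
      rw [Nat.le_div_iff_mul_le hl]
      have := Nat.div_add_mod s.card l
      rw [← hm] at this
      have : (m + 1) * l = l * m + l := by ring
      omega
  -- A bad element lies in no part of Q contained in its `C`-class, and each `C`-class has at most m
  -- such elements.
  · calc _ ≤ (P.parts.biUnion fun p => p \ (Q.parts.filter fun y => y ⊆ p).biUnion id).card := by
          refine card_le_card fun x hx => ?_
          obtain ⟨hxs, y, hys, hyx, hC⟩ := mem_filter.1 hx
          refine mem_biUnion.2 ⟨P.part x, P.part_mem.2 hxs, mem_sdiff.2
            ⟨P.mem_part_self.2 hxs, fun hx' => hC ?_⟩⟩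
          obtain ⟨t, ht, hxt⟩ := mem_biUnion.1 hx'
          obtain ⟨htQ, htP⟩ := mem_filter.1 ht
          rw [hh x hxs, hh y hys, e.apply_eq_iff_eq, Subtype.mk.injEq,
            Q.part_eq_of_mem htQ hxt] at hyx
          have hyt : y ∈ t := hyx ▸ Q.mem_part_self.2 hys
          exact ((Finpartition.mem_part_ofSetSetoid_iff_rel s).1 (htP hyt)).2.2.symm
      _ ≤ ∑ p ∈ P.parts, (p \ (Q.parts.filter fun y => y ⊆ p).biUnion id).card := card_biUnion_le
      _ ≤ ∑ _p ∈ P.parts, m := sum_le_sum fun p hp => P.card_parts_equitabilise_subset_le hcard hp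
      _ ≤ _ := by
          rw [sum_const, smul_eq_mul]
          exact Nat.mul_le_mul_right _ hPcard

variable [Fintype V]

/-- The classes of the labeling `f` are non-empty and their sizes differ by at most one. -/
structure Equitable (f : V → ι) : Prop where
  surjective : Function.Surjective f
  card_le : ∀ i i', (fiber f i).card ≤ (fiber f i').card + 1

theorem Equitable.isEquipartition {f : V → ι} (hf : Equitable f) :
    IsEquipartition (fun i => fiber f i) where
  nonempty i := by
    obtain ⟨x, hx⟩ := hf.surjective i
    exact ⟨x, by simpa using hx⟩
  disjoint i i' h := by
    rw [disjoint_left]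
    intro x hx hx'
    rw [mem_fiber] at hx hx'
    exact h (hx.symm.trans hx')
  cover v := ⟨f v, by simp⟩
  card_le := hf.card_le

theorem fiber_equiv_comp (f : V → ι) (e : ι ≃ κ) (i : ι) : fiber (e ∘ f) (e i) = fiber f i := by
  ext x
  simp

theorem Equitable.equiv_comp {f : V → ι} (hf : Equitable f) (e : ι ≃ κ) : Equitable (e ∘ f) where
  surjective := e.surjective.comp hf.surjective
  card_le i i' := by
    obtain ⟨i, rfl⟩ := e.surjective i
    obtain ⟨i', rfl⟩ := e.surjective i'
    simpa only [fiber_equiv_comp] using hf.card_le i i'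

theorem sum_card_fiber [Fintype ι] (f : V → ι) : ∑ i, (fiber f i).card = Fintype.card V := by
  classical
  rw [← card_univ, card_eq_sum_card_fiberwise (f := f) (t := univ) (by simp)]
  refine sum_congr rfl fun i _ => ?_
  congr 1

theorem Equitable.card_le_mul_card_fiber [Fintype ι] {f : V → ι} (hf : Equitable f) (i : ι) :
    Fintype.card V ≤ 2 * Fintype.card ι * (fiber f i).card := by
  have hi : 1 ≤ (fiber f i).card := card_pos.2 (hf.isEquipartition.nonempty i)
  calc Fintype.card V = ∑ i', (fiber f i').card := (sum_card_fiber f).symm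
    _ ≤ ∑ _i' : ι, 2 * (fiber f i).card := sum_le_sum fun i' _ => by
        have := hf.card_le i' i
        omega
    _ = _ := by simp; ring

end Equitable

/-! ### Equitable refinements approximating a given labeling -/

section Regularity

variable {V K ι κ : Type*} [Fintype V]

/-- An equitable labeling `f` has an equitable refinement, with `l` labels in each class of `f`,
such that few elements lie in a class on which a given labeling `C` is not constant. -/
theorem Equitable.exists_refinement [Fintype ι] [Fintype κ] {f : V → ι} (hf : Equitable f)
    (C : V → κ) {l : ℕ} (hl : 0 < l) (hV : 2 * Fintype.card ι * l ≤ Fintype.card V) :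
    ∃ h : V → Fin l, Equitable (fun x => (f x, h x)) ∧
      ∃ Z : Finset V, (∀ x y, (f x, h x) = (f y, h y) → C x ≠ C y → x ∈ Z) ∧
        Z.card * l ≤ Fintype.card κ * Fintype.card V := by
  classical
  have hl' : ∀ i, l ≤ (fiber f i).card := fun i => by
    have h₁ := hV.trans (hf.card_le_mul_card_fiber i)
    have : 0 < Fintype.card ι := Fintype.card_pos_iff.2 ⟨i⟩
    exact Nat.le_of_mul_le_mul_left h₁ (by positivity)
  choose h h₁ h₂ using fun i => exists_equitable_split (fiber f i) C hl (hl' i)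
  have hfib : ∀ p : ι × Fin l, fiber (fun x => (f x, h (f x) x)) p =
      (fiber f p.1).filter fun x => h p.1 x = p.2 := fun p => by
    ext x
    simp only [mem_fiber, mem_filter, Prod.ext_iff]
    constructor
    · rintro ⟨h, h'⟩
      exact ⟨h, h ▸ h'⟩
    · rintro ⟨h, h'⟩
      exact ⟨h, h ▸ h'⟩
  refine ⟨fun x => h (f x) x, ⟨fun p => ?_, fun p p' => ?_⟩,
    univ.biUnion fun i => (fiber f i).filter fun x => ∃ y ∈ fiber f i, h i y = h i x ∧ C y ≠ C x,
    fun x y hxy hC => ?_, ?_⟩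
  · have : 0 < (fiber (fun x => (f x, h (f x) x)) p).card := by
      rw [hfib]
      exact (Nat.div_pos (hl' _) hl).trans_le (h₁ p.1 p.2).1
    obtain ⟨x, hx⟩ := card_pos.1 this
    exact ⟨x, (mem_fiber (F := fun x => (f x, h (f x) x))).1 hx⟩
  · rw [hfib, hfib]
    refine ((h₁ p.1 p.2).2.trans ?_).trans (Nat.add_le_add_right (h₁ p'.1 p'.2).1 1)
    -- If a ≤ b + 1, the ceiling of a / l is at most one more than the floor of b / l. Thus sizes
    -- stay balanced even across different classes of `f`.
    rw [← Nat.add_div_right _ hl]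
    have := hf.card_le p.1 p'.1
    exact Nat.div_le_div_right (by omega)
  · simp only [Prod.mk.injEq] at hxy
    refine mem_biUnion.2 ⟨f x, mem_univ _, mem_filter.2 ⟨by simp, y, by simp [hxy.1], ?_, hC.symm⟩⟩
    rw [hxy.2, hxy.1]
  · calc _ ≤ (∑ i, Fintype.card κ * ((fiber f i).card / l)) * l :=
          Nat.mul_le_mul_right _ (card_biUnion_le.trans (sum_le_sum fun i _ => h₂ i))
      _ = Fintype.card κ * ∑ i, (fiber f i).card / l * l := by
          rw [← mul_sum, mul_assoc, sum_mul]
      _ ≤ Fintype.card κ * ∑ i, (fiber f i).card :=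
          Nat.mul_le_mul_left _ (sum_le_sum fun i _ => Nat.div_mul_le_self _ _)
      _ = _ := by rw [sum_card_fiber]

variable [Fintype K]

/-- The loss is the measure of the pairs meeting the bad set `Z`, where |Z| ≤ |κ||V| / l; a large l
makes it negligible. -/
theorem Equitable.exists_refinement_energy [Fintype ι] [Fintype κ] {f : V → ι} (hf : Equitable f)
    (col : K → V → V → Prop) (C : V → κ) {l : ℕ} (hl : 0 < l)
    (hV : 2 * Fintype.card ι * l ≤ Fintype.card V) :
    ∃ h : V → Fin l, Equitable (fun x => (f x, h x)) ∧
      energy col C ≤ energy col (fun x => (f x, h x)) +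
        2 * Fintype.card K * Fintype.card κ / l * (Fintype.card V : ℝ) ^ 2 := by
  obtain ⟨h, hh, Z, hZ, hZcard⟩ := hf.exists_refinement C hl hV
  refine ⟨h, hh, (energy_le_add_of_bad col _ C Z hZ).trans ?_⟩
  have hl0 : (0 : ℝ) < l := by exact_mod_cast hl
  have h₁ : (Z.card : ℝ) ≤ Fintype.card κ * Fintype.card V / l := by
    rw [le_div_iff₀ hl0]
    exact_mod_cast hZcard
  have : 2 * (Fintype.card K : ℝ) * Z.card * Fintype.card V ≤
      2 * Fintype.card K * (Fintype.card κ * Fintype.card V / l) * Fintype.card V := by gcongr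
  calc _ ≤ energy col (fun x => (f x, h x)) +
        2 * Fintype.card K * (Fintype.card κ * Fintype.card V / l) * Fintype.card V := by gcongr
    _ = _ := by ring

/-- If many pairs of classes of an equitable labeling `g` are irregular, then some labeling has
much larger energy. -/
theorem Equitable.exists_energy_increment [Fintype ι] {g : V → ι} (hg : Equitable g)
    (col : K → V → V → Prop) {ε : ℝ} (hε : 0 < ε)
    (hirr : ε * (Fintype.card ι : ℝ) ^ 2 < (irregularPairs col ε g).card) :
    ∃ C : V → ι × (ι × ι → Bool × Bool),
      energy col g + ε ^ 5 / 4 * (Fintype.card V : ℝ) ^ 2 ≤ energy col C := by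
  obtain ⟨C, hC⟩ := ColoredRegularity.exists_energy_increment col g hε
  refine ⟨C, le_trans ?_ hC⟩
  rcases (irregularPairs col ε g).eq_empty_or_nonempty with h | ⟨p₀, -⟩
  · rw [h, card_empty, Nat.cast_zero] at hirr
    exact absurd hirr (not_lt.2 (by positivity))
  have hι : (0 : ℝ) < Fintype.card ι := by
    exact_mod_cast Fintype.card_pos_iff.2 ⟨p₀.1⟩
  have hcell : ∀ i, (Fintype.card V : ℝ) / (2 * Fintype.card ι) ≤ (fiber g i).card := fun i => by
    rw [div_le_iff₀ (by positivity), mul_comm]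
    exact_mod_cast hg.card_le_mul_card_fiber i
  have h₁ : (irregularPairs col ε g).card *
      ((Fintype.card V : ℝ) / (2 * Fintype.card ι)) ^ 2 ≤ ∑ p ∈ irregularPairs col ε g,
        ((fiber g p.1).card : ℝ) * (fiber g p.2).card := by
    rw [← nsmul_eq_mul]
    refine card_nsmul_le_sum _ _ _ fun p _ => ?_
    rw [sq]
    exact mul_le_mul (hcell _) (hcell _) (by positivity) (by positivity)
  have h₂ : ε ^ 5 / 4 * (Fintype.card V : ℝ) ^ 2 = ε ^ 4 * (ε * (Fintype.card ι : ℝ) ^ 2 *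
      ((Fintype.card V : ℝ) / (2 * Fintype.card ι)) ^ 2) := by
    field_simp
    ring
  rw [h₂]
  gcongr
  refine le_trans ?_ h₁
  gcongr

end Regularity

-- Regularity lemma by energy increment

universe u v w

/-- Induction on the energy budget: `t` bounds the number of gains of ε⁵|V|²/8 still possible, and
at `t = 0` the energy would exceed its maximum. The new labeling refines `f` but need not refine
`(f, h)`; only its energy matters. -/
theorem exists_regular_refinement_aux (K : Type v) [Fintype K] (ι : Type w) [Fintype ι]
    {ε : ℝ} (hε : 0 < ε) (t l : ℕ) (hl : 0 < l) :
    ∃ L : ℕ, ∀ (V : Type u) [Fintype V] (col : K → V → V → Prop), L ≤ Fintype.card V →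
      ∀ f : V → ι, Equitable f → ∀ h : V → Fin l, Equitable (fun x => (f x, h x)) →
      (Fintype.card K - t * (ε ^ 5 / 8)) * (Fintype.card V : ℝ) ^ 2 <
        energy col (fun x => (f x, h x)) →
      ∃ l' ≤ L, 0 < l' ∧ ∃ h' : V → Fin l', Equitable (fun x => (f x, h' x)) ∧
        ((irregularPairs col ε (fun x => (f x, h' x))).card : ℝ) ≤
          ε * (Fintype.card (ι × Fin l') : ℝ) ^ 2 := by
  classical
  induction t generalizing l with
  | zero =>
    refine ⟨0, fun V _ col _ f _ h _ hlt => absurd (energy_le col (fun x => (f x, h x))) ?_⟩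
    simpa using hlt
  | succ t ih =>
    set M := Fintype.card ((ι × Fin l) × ((ι × Fin l) × (ι × Fin l) → Bool × Bool)) with hM
    -- With this l' the equitable approximation loses at most half of the gain ε⁵|V|²/4.
    obtain ⟨l', hl'⟩ := exists_nat_gt (2 * (Fintype.card K : ℝ) * M / (ε ^ 5 / 8))
    have hl'0 : 0 < l' := by
      have : (0 : ℝ) < l' := lt_of_le_of_lt (by positivity) hl'
      exact_mod_cast this
    obtain ⟨L, hL⟩ := ih l' hl'0
    refine ⟨max (max l (2 * Fintype.card ι * l')) L, fun V _ col hV f hf h hh hlt => ?_⟩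
    simp only [max_le_iff] at hV
    by_cases hirr : ((irregularPairs col ε (fun x => (f x, h x))).card : ℝ) ≤
          ε * (Fintype.card (ι × Fin l) : ℝ) ^ 2
    · exact ⟨l, (le_max_left _ _).trans (le_max_left _ _), hl, h, hh, hirr⟩
    obtain ⟨C, hC⟩ := hh.exists_energy_increment col hε (not_le.1 hirr)
    obtain ⟨h', hh', hE⟩ := hf.exists_refinement_energy col C hl'0 hV.1.2
    have h₁ : 2 * (Fintype.card K : ℝ) * M / l' ≤ ε ^ 5 / 8 := by
      have h8 : 0 < ε ^ 5 / 8 := by positivity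
      rw [div_lt_iff₀ h8] at hl'
      rw [div_le_iff₀ (by exact_mod_cast hl'0)]
      linarith
    have h₂ : 2 * (Fintype.card K : ℝ) * M / l' * (Fintype.card V : ℝ) ^ 2 ≤
        ε ^ 5 / 8 * (Fintype.card V : ℝ) ^ 2 := by gcongr
    obtain ⟨l₂, hl₂, hreg⟩ := hL V col hV.2 f hf h' hh' (by push_cast at hlt; linarith)
    exact ⟨l₂, hl₂.trans (le_max_right _ _), hreg⟩

/-- A regularity lemma: an equitable labeling has an equitable refinement of bounded size almost
all of whose pairs of classes are `ε`-regular. -/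
theorem exists_regular_refinement (K : Type v) [Fintype K] (ι : Type w) [Fintype ι]
    {ε : ℝ} (hε : 0 < ε) :
    ∃ L : ℕ, ∀ (V : Type u) [Fintype V] (col : K → V → V → Prop), L ≤ Fintype.card V →
      ∀ f : V → ι, Equitable f →
      ∃ l ≤ L, 0 < l ∧ ∃ h : V → Fin l, Equitable (fun x => (f x, h x)) ∧
        ((irregularPairs col ε (fun x => (f x, h x))).card : ℝ) ≤
          ε * (Fintype.card (ι × Fin l) : ℝ) ^ 2 := by
  have h8 : 0 < ε ^ 5 / 8 := by positivity
  obtain ⟨t, ht⟩ := exists_nat_gt ((Fintype.card K : ℝ) / (ε ^ 5 / 8))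
  rw [div_lt_iff₀ h8] at ht
  obtain ⟨L, hL⟩ := exists_regular_refinement_aux K ι hε t 1 one_pos
  refine ⟨max L 1, fun V _ col hV f hf => ?_⟩
  have hV0 : (0 : ℝ) < Fintype.card V := by exact_mod_cast (le_max_right L 1).trans hV
  obtain ⟨l, hl, h⟩ := hL V col ((le_max_left _ _).trans hV) f hf (fun _ => 0)
    (hf.equiv_comp (Equiv.prodUnique ι (Fin 1)).symm)
    (lt_of_lt_of_le (mul_neg_of_neg_of_pos (by linarith) (by positivity)) (energy_nonneg col _))
  exact ⟨l, hl.trans (le_max_left _ _), h⟩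

/-! ### Small energy gap and closeness of densities -/

section DensityClose

variable {V K : Type*} [Fintype V] [Fintype K]

open Classical in
/-- The pairs of refined classes inside the pair `p` of classes of `f` that have some density
differing from that of `p` by at least `a`. -/
noncomputable def deviatingPairs {k l : ℕ} (col : K → V → V → Prop) (f : V → Fin k)
    (h : V → Fin l) (a : ℝ) (p : Fin k × Fin k) : Finset (Fin l × Fin l) :=
  univ.filter fun q => ¬ ∀ ρ : K, |colorDensity col ρ (fiber f p.1) (fiber f p.2) -
    colorDensity col ρ (fiber (fun x => (f x, h x)) (p.1, q.1))
      (fiber (fun x => (f x, h x)) (p.2, q.2))| < a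

/-- Chebyshev's inequality: each deviating pair of refined classes contributes at least a² times its
area to the energy gap, and its area is at least (|V| / (2kl))². -/
theorem sum_card_deviatingPairs_le {k l : ℕ} (col : K → V → V → Prop) {f : V → Fin k}
    {h : V → Fin l} (hh : Equitable (fun x => (f x, h x))) {a : ℝ} (ha : 0 ≤ a) :
    (∑ p, ((deviatingPairs col f h a p).card : ℝ)) * a ^ 2 * (Fintype.card V : ℝ) ^ 2 ≤
      (2 * (k * l)) ^ 2 * (energy col (fun x => (f x, h x)) - energy col f) := by
  classical
  set g : V → Fin k × Fin l := fun x => (f x, h x) with hg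
  rw [energy_sub_energy col f g fun x y hxy => congrArg Prod.fst hxy]
  set Φ : V × V → ℝ := fun ω => ∑ ρ, (fiberMean (Prod.map g g) (colorIndicator col ρ) ω -
        fiberMean (Prod.map f f) (colorIndicator col ρ) ω) ^ 2 with hΦ
  have hΦ0 : ∀ ω, 0 ≤ Φ ω := fun ω => sum_nonneg fun _ _ => sq_nonneg _
  have h₁ : ∑ ω, Φ ω = ∑ p : Fin k × Fin k, ∑ q : Fin l × Fin l,
      ∑ ω ∈ fiber g (p.1, q.1) ×ˢ fiber g (p.2, q.2), Φ ω := by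
    rw [← Fintype.sum_prod_type' (f := fun (p : Fin k × Fin k) (q : Fin l × Fin l) =>
      ∑ ω ∈ fiber g (p.1, q.1) ×ˢ fiber g (p.2, q.2), Φ ω), ← sum_fiberwise univ
      (fun ω : V × V => ((f ω.1, f ω.2), (h ω.1, h ω.2))) Φ]
    refine sum_congr rfl fun c _ => sum_congr ?_ fun _ _ => rfl
    ext ω
    simp only [hg, mem_filter, mem_univ, true_and, mem_product, mem_fiber, Prod.ext_iff]
    tauto
  have hcell : ∀ i, (Fintype.card V : ℝ) ≤ 2 * (k * l) * (fiber g i).card := fun i => by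
    have := hh.card_le_mul_card_fiber i
    simp only [Fintype.card_prod, Fintype.card_fin] at this
    exact_mod_cast this
  have h₂ : ∀ p, ∀ q ∈ deviatingPairs col f h a p, a ^ 2 * (Fintype.card V : ℝ) ^ 2 ≤
      (2 * (k * l)) ^ 2 * ∑ ω ∈ fiber g (p.1, q.1) ×ˢ fiber g (p.2, q.2), Φ ω := by
    intro p q hq
    simp only [deviatingPairs, mem_filter, mem_univ, true_and, not_forall, not_lt] at hq
    obtain ⟨ρ, hρ⟩ := hq
    have h₃ : ∀ ω ∈ fiber g (p.1, q.1) ×ˢ fiber g (p.2, q.2), a ^ 2 ≤ Φ ω := by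
      intro ω hω
      simp only [mem_product, mem_fiber] at hω
      have hf₁ : f ω.1 = p.1 := congrArg Prod.fst hω.1
      have hf₂ : f ω.2 = p.2 := congrArg Prod.fst hω.2
      refine le_trans ?_ (single_le_sum (f := fun ρ =>
        (fiberMean (Prod.map g g) (colorIndicator col ρ) ω -
          fiberMean (Prod.map f f) (colorIndicator col ρ) ω) ^ 2)
        (fun _ _ => sq_nonneg _) (mem_univ ρ))
      rw [fiberMean_prodMap, fiberMean_prodMap, hω.1, hω.2, hf₁, hf₂, ← sq_abs (_ - _), abs_sub_comm]
      exact pow_le_pow_left₀ ha hρ 2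
    have h₄ := card_nsmul_le_sum _ _ _ h₃
    rw [nsmul_eq_mul, card_product, Nat.cast_mul] at h₄
    calc a ^ 2 * (Fintype.card V : ℝ) ^ 2
        = a ^ 2 * (Fintype.card V * Fintype.card V) := by ring
      _ ≤ a ^ 2 * ((2 * (k * l) * (fiber g (p.1, q.1)).card) *
            (2 * (k * l) * (fiber g (p.2, q.2)).card)) := by
          gcongr
          · exact hcell _
          · exact hcell _
      _ = (2 * (k * l)) ^ 2 *
            ((fiber g (p.1, q.1)).card * (fiber g (p.2, q.2)).card * a ^ 2) := by ring
      _ ≤ _ := by gcongr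
  rw [h₁, mul_sum, sum_mul, sum_mul]
  refine sum_le_sum fun p _ => ?_
  rw [mul_assoc, ← nsmul_eq_mul]
  refine (card_nsmul_le_sum _ _ _ (h₂ p)).trans ?_
  rw [← mul_sum]
  gcongr
  exact subset_univ _

theorem sq_le_four_mul_choose_two {k : ℕ} (hk : 2 ≤ k) : (k : ℝ) ^ 2 ≤ 4 * (k.choose 2 : ℝ) := by
  rw [Nat.cast_choose_two]
  have : (2 : ℝ) ≤ k := by exact_mod_cast hk
  nlinarith

/-- An almost regular equitable labeling and an even more regular refinement of almost the same
energy satisfy the strong regularity lemma. -/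
theorem isRegularRefinement_of_energy {k l : ℕ} (hk : 2 ≤ k) (hl : 0 < l)
    (col : K → V → V → Prop) {E : ℕ → ℝ} (hE : ∀ t, E t ∈ Set.Ioo (0 : ℝ) 1)
    {f : V → Fin k} {h : V → Fin l} (hf : Equitable f) (hh : Equitable (fun x => (f x, h x)))
    (hfreg : ((irregularPairs col (E 0 / 4) f).card : ℝ) ≤ E 0 / 4 * (k : ℝ) ^ 2)
    (hhreg : ((irregularPairs col (E k / (k + 1) ^ 2) (fun x => (f x, h x))).card : ℝ) ≤
      E k / (k + 1) ^ 2 * ((k : ℝ) * l) ^ 2)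
    (hen : energy col (fun x => (f x, h x)) ≤
      energy col f + E 0 ^ 4 / 16 * (Fintype.card V : ℝ) ^ 2) :
    IsRegularRefinement col E (fun i => fiber f i)
      (fun i j => fiber (fun x => (f x, h x)) (i, j)) where
  equipartition := hf.isEquipartition
  equipartition_refinement := hh.isEquipartition
  refines i v := by simp
  regular := by
    classical
    have h0 := (hE 0).1
    calc _ ≤ ((irregularPairs col (E 0 / 4) f).card : ℝ) := by
          refine Nat.cast_le.2 (card_le_card fun p hp => ?_)
          exact irregularPairs_anti (by linarith) f (mem_irregularPairs.2 (mem_filter.1 hp).2.2)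
      _ ≤ E 0 / 4 * (k : ℝ) ^ 2 := hfreg
      _ ≤ E 0 / 4 * (4 * (k.choose 2 : ℝ)) := by
          gcongr
          exact sq_le_four_mul_choose_two hk
      _ = _ := by ring
  regular_refinement i i' _ := by
    classical
    have h0 := (hE k).1
    have hk1 : (1 : ℝ) ≤ (k + 1 : ℝ) ^ 2 := one_le_pow₀ (by simp)
    calc _ ≤ ((irregularPairs col (E k / (k + 1) ^ 2) (fun x => (f x, h x))).card : ℝ) := by
          refine Nat.cast_le.2 (card_le_card_of_injOn (fun q => ((i, q.1), (i', q.2))) ?_ ?_)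
          · intro q hq
            exact irregularPairs_anti (div_le_self h0.le hk1) _
              (mem_irregularPairs.2 (mem_filter.1 (mem_coe.1 hq)).2)
          · intro q _ q' _ hqq
            simp only [Prod.mk.injEq, true_and] at hqq
            exact Prod.ext hqq.1 hqq.2
      _ ≤ E k / (k + 1) ^ 2 * ((k : ℝ) * l) ^ 2 := hhreg
      _ ≤ E k / (k + 1) ^ 2 * (((k : ℝ) + 1) * l) ^ 2 := by gcongr; linarith
      _ = _ := by field_simp
  density_close := by
    classical
    have h0 := (hE 0).1
    have hV0 : (0 : ℝ) < Fintype.card V := by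
      obtain ⟨x, -⟩ := hf.surjective ⟨0, by omega⟩
      exact_mod_cast Fintype.card_pos_iff.2 ⟨x⟩
    have hl0 : (0 : ℝ) < l := by exact_mod_cast hl
    have hsum := sum_card_deviatingPairs_le col hh h0.le
    set T : Finset (Fin k × Fin k) :=
      univ.filter fun p => E 0 * (l : ℝ) ^ 2 < (deviatingPairs col f h (E 0) p).card with hT
    -- Markov's inequality passes from the total number of deviating pairs to the number of coarse
    -- pairs containing too many of them.
    have h₁ : (T.card : ℝ) * (E 0 * (l : ℝ) ^ 2) ≤
        ∑ p, ((deviatingPairs col f h (E 0) p).card : ℝ) := by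
      rw [← nsmul_eq_mul]
      refine (card_nsmul_le_sum T _ _ fun p hp => (mem_filter.1 hp).2.le).trans ?_
      exact sum_le_sum_of_subset_of_nonneg (subset_univ _) fun _ _ _ => Nat.cast_nonneg _
    have h₂ : (T.card : ℝ) ≤ E 0 / 4 * (k : ℝ) ^ 2 := by
      have hc : 0 < E 0 ^ 3 * (l : ℝ) ^ 2 * (Fintype.card V : ℝ) ^ 2 := by positivity
      refine le_of_mul_le_mul_right ?_ hc
      calc (T.card : ℝ) * (E 0 ^ 3 * (l : ℝ) ^ 2 * (Fintype.card V : ℝ) ^ 2)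
          = (T.card : ℝ) * (E 0 * (l : ℝ) ^ 2) * E 0 ^ 2 * (Fintype.card V : ℝ) ^ 2 := by ring
        _ ≤ (∑ p, ((deviatingPairs col f h (E 0) p).card : ℝ)) * E 0 ^ 2 *
              (Fintype.card V : ℝ) ^ 2 := by gcongr
        _ ≤ _ := hsum
        _ ≤ (2 * (k * l)) ^ 2 * (E 0 ^ 4 / 16 * (Fintype.card V : ℝ) ^ 2) := by
            gcongr
            linarith
        _ = _ := by ring
    calc _ ≤ (T.card : ℝ) := by
          refine Nat.cast_le.2 (card_le_card fun p hp => ?_)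
          refine mem_filter.2 ⟨mem_univ _, (not_le.1 (mem_filter.1 hp).2.2).trans_eq ?_⟩
          unfold deviatingPairs
          congr!
      _ ≤ E 0 / 4 * (k : ℝ) ^ 2 := h₂
      _ ≤ E 0 / 4 * (4 * (k.choose 2 : ℝ)) := by
          gcongr
          exact sq_le_four_mul_choose_two hk
      _ = _ := by ring

end DensityClose

/-! ### Strong regularity lemma by iterated refinement -/

theorem card_irregularPairs_equiv_comp {V K ι κ : Type*} [Fintype V] [Fintype ι] [Fintype κ]
    (col : K → V → V → Prop) (γ : ℝ) (f : V → ι) (e : ι ≃ κ) :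
    (irregularPairs col γ (e ∘ f)).card = (irregularPairs col γ f).card := by
  symm
  refine card_equiv (e.prodCongr e) fun p => ?_
  simp only [mem_irregularPairs, Equiv.prodCongr_apply, Prod.map_fst, Prod.map_snd,
    fiber_equiv_comp]

/-- Induction on the budget of gains of E(0)⁴|V|²/16. The bound `N` on k makes `S` independent of
the graph, although the regularity required of the refinement depends on k. -/
theorem exists_isRegularRefinement_aux (K : Type v) [Fintype K] (m : ℤ) {E : ℕ → ℝ}
    (hE : ∀ t, E t ∈ Set.Ioo (0 : ℝ) 1) (t N : ℕ) :
    ∃ S : ℕ, ∀ (V : Type u) [Fintype V] (col : K → V → V → Prop), S ≤ Fintype.card V →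
      ∀ k ≤ N, 2 ≤ k → m ≤ k → ∀ f : V → Fin k, Equitable f →
      ((irregularPairs col (E 0 / 4) f).card : ℝ) ≤ E 0 / 4 * (k : ℝ) ^ 2 →
      (Fintype.card K - t * (E 0 ^ 4 / 16)) * (Fintype.card V : ℝ) ^ 2 < energy col f →
      ∃ (k l : ℕ) (A : Fin k → Finset V) (B : Fin k → Fin l → Finset V),
        m ≤ (k : ℤ) ∧ k * l ≤ S ∧ IsRegularRefinement col E A B := by
  induction t generalizing N with
  | zero =>
    refine ⟨0, fun V _ col _ k _ _ _ f _ _ hlt => absurd (energy_le col f) ?_⟩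
    simpa using hlt
  | succ t ih =>
    -- The first entry serves condition 2: all irregular pairs might lie over one coarse pair, so a
    -- factor k² must be absorbed, and k + 1 avoids division by zero. The second lets the refinement
    -- be the next coarse partition.
    set ε : ℕ → ℝ := fun k => min (E k / (k + 1) ^ 2) (E 0 / 4) with hε
    have hε0 : ∀ k, 0 < ε k := fun k => by
      have h0 := (hE 0).1
      have hk := (hE k).1
      exact lt_min (by positivity) (by positivity)
    choose L hL using fun k => exists_regular_refinement.{u} K (Fin k) (hε0 k)
    -- For every k ≤ N this bounds both the number k * l of refined classes and the size `L k`
    -- required of V.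
    set N' := ∑ k ∈ range (N + 1), (k * L k + L k) with hN'
    have hLN : ∀ k ≤ N, k * L k + L k ≤ N' := fun k hk =>
      single_le_sum (f := fun k => k * L k + L k) (fun _ _ => Nat.zero_le _)
        (mem_range.2 (Nat.lt_succ_of_le hk))
    obtain ⟨S, hS⟩ := ih N'
    refine ⟨max N' S, fun V _ col hV k hkN hk hmk f hf hreg hlt => ?_⟩
    rw [max_le_iff] at hV
    have hkN' := hLN k hkN
    obtain ⟨l, hlL, hl, h, hh, hirr⟩ := hL k V col (by omega) f hf
    have hkl : k * l ≤ N' := (Nat.mul_le_mul_left k hlL).trans (by omega)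
    have hirr' : ∀ γ, ε k ≤ γ →
        ((irregularPairs col γ (fun x => (f x, h x))).card : ℝ) ≤ γ * ((k : ℝ) * l) ^ 2 :=
      fun γ hγ => by
        refine (Nat.cast_le.2 (card_le_card (irregularPairs_anti hγ _))).trans (hirr.trans ?_)
        rw [Fintype.card_prod, Fintype.card_fin, Fintype.card_fin, Nat.cast_mul]
        gcongr
    by_cases hen : energy col (fun x => (f x, h x)) ≤
      energy col f + E 0 ^ 4 / 16 * (Fintype.card V : ℝ) ^ 2
    · exact ⟨k, l, _, _, hmk, hkl.trans (le_max_left _ _),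
        isRegularRefinement_of_energy hk hl col hE hf hh hreg (hirr' _ (min_le_left _ _)) hen⟩
    · have hkk : k ≤ k * l := Nat.le_mul_of_pos_right k hl
      obtain ⟨k', l', A, B, hm', hkl', hAB⟩ := hS V col hV.2 (k * l) hkl (hk.trans hkk)
        (hmk.trans (by exact_mod_cast hkk)) (finProdFinEquiv ∘ fun x => (f x, h x))
        (hh.equiv_comp _)
        (by
          rw [card_irregularPairs_equiv_comp, Nat.cast_mul]
          exact hirr' _ (min_le_right _ _))
        (by
          rw [energy_congr_equiv]
          push_cast at hlt
          linarith)
      exact ⟨k', l', A, B, hm', hkl'.trans (le_max_right _ _), hAB⟩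

/-- The strong regularity lemma for finitely many binary relations. -/
theorem exists_isRegularRefinement (K : Type v) [Fintype K] (m : ℤ) {E : ℕ → ℝ}
    (hE : ∀ t, E t ∈ Set.Ioo (0 : ℝ) 1) :
    ∃ S : ℕ, ∀ (V : Type u) [Fintype V] (col : K → V → V → Prop), S ≤ Fintype.card V →
      ∃ (k l : ℕ) (A : Fin k → Finset V) (B : Fin k → Fin l → Finset V),
        m ≤ (k : ℤ) ∧ k * l ≤ S ∧ IsRegularRefinement col E A B := by
  have h0 := (hE 0).1
  -- The number of classes only grows later. Two classes are needed for k² ≤ 4 (k choose 2).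
  set k₀ : ℕ := max 2 m.toNat with hk₀
  obtain ⟨L, hL⟩ := exists_regular_refinement.{u} K (Fin k₀) (ε := E 0 / 4) (by positivity)
  have h16 : 0 < E 0 ^ 4 / 16 := by positivity
  obtain ⟨t, ht⟩ := exists_nat_gt ((Fintype.card K : ℝ) / (E 0 ^ 4 / 16))
  rw [div_lt_iff₀ h16] at ht
  obtain ⟨S, hS⟩ := exists_isRegularRefinement_aux.{u} K m hE t (k₀ * L)
  refine ⟨max (max (2 * k₀) L) S, fun V _ col hV => ?_⟩
  simp only [max_le_iff] at hV
  have hk₀2 : 2 ≤ k₀ := le_max_left _ _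
  have hVpos : 0 < Fintype.card V := by omega
  have hV0 : (0 : ℝ) < Fintype.card V := by exact_mod_cast hVpos
  have htriv : Equitable (fun _ : V => ()) :=
    ⟨fun _ => ⟨(Fintype.card_pos_iff.1 hVpos).some, rfl⟩, fun _ _ => Nat.le_succ _⟩
  -- An arbitrary equipartition into k₀ classes, obtained by splitting the one-class partition.
  obtain ⟨f, hf, -⟩ := htriv.exists_refinement (fun _ => ()) (l := k₀) (by omega)
    (by simpa using hV.1.1)
  obtain ⟨l, hlL, hl, h, hh, hirr⟩ := hL V col hV.1.2 f (hf.equiv_comp (Equiv.punitProd (Fin k₀)))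
  have hkk : k₀ ≤ k₀ * l := Nat.le_mul_of_pos_right k₀ hl
  obtain ⟨k', l', A, B, hm', hkl', hAB⟩ := hS V col hV.2 (k₀ * l) (Nat.mul_le_mul_left _ hlL)
    (hk₀2.trans hkk)
    ((Int.self_le_toNat m).trans (by exact_mod_cast (le_max_right _ _).trans hkk))
    (finProdFinEquiv ∘ fun x => (f x, h x)) (hh.equiv_comp _)
    (by
      rw [card_irregularPairs_equiv_comp]
      simpa using hirr)
    (lt_of_lt_of_le (mul_neg_of_neg_of_pos (by linarith) (by positivity)) (energy_nonneg col _))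
  exact ⟨k', l', A, B, hm', hkl'.trans (le_max_right _ _), hAB⟩

instance : Fintype ArcColor where
  elems := ⟨{.nonArc, .bothArcs, .backward, .forward}, by simp⟩
  complete c := by cases c <;> simp

end ColoredRegularity

theorem mainTheorem2 (r : ℕ) (hr : 0 < r) (m : ℤ) (E : ℕ → ℝ)
    (hE : ∀ t, E t ∈ Set.Ioo (0 : ℝ) 1) :
    ∃ S : ℕ,
      (∀ (V : Type*) [Fintype V] (c : SimpleGraph.TopEdgeLabeling V (Fin r)),
        S ≤ Fintype.card V →
        ∃ (k l : ℕ) (A : Fin k → Finset V) (B : Fin k → Fin l → Finset V),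
          m ≤ (k : ℤ) ∧ k * l ≤ S ∧
          ColoredRegularity.IsRegularRefinement (ColoredRegularity.edgeHasColor c) E A B) ∧
      (∀ (V : Type*) [Fintype V] (G : Digraph V), (∀ v, ¬ G.Adj v v) →
        S ≤ Fintype.card V →
        ∃ (k l : ℕ) (A : Fin k → Finset V) (B : Fin k → Fin l → Finset V),
          m ≤ (k : ℤ) ∧ k * l ≤ S ∧
          ColoredRegularity.IsRegularRefinement (ColoredRegularity.arcHasColor G) E A B) := by
  obtain ⟨S₁, h₁⟩ := ColoredRegularity.exists_isRegularRefinement (Fin r) m hE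
  obtain ⟨S₂, h₂⟩ := ColoredRegularity.exists_isRegularRefinement ColoredRegularity.ArcColor m hE
  refine ⟨max S₁ S₂, fun V _ c hV => ?_, fun V _ G _ hV => ?_⟩
  · obtain ⟨k, l, A, B, hm, hkl, hAB⟩ :=
      h₁ V (ColoredRegularity.edgeHasColor c) ((le_max_left _ _).trans hV)
    exact ⟨k, l, A, B, hm, hkl.trans (le_max_left _ _), hAB⟩
  · obtain ⟨k, l, A, B, hm, hkl, hAB⟩ :=
      h₂ V (ColoredRegularity.arcHasColor G) ((le_max_right _ _).trans hV)
    exact ⟨k, l, A, B, hm, hkl.trans (le_max_right _ _), hAB⟩
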